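/- Digraphs are finite, without loops and without parallel arcs (two opposite arcs between two vertices are allowed). A digraph is connected if its underlying undirected graph is connected (in particular, it has at least one vertex). For an integer $s\ge 1$, a digraph $D$ is weakly $s$-degenerate if every non-empty subdigraph $D'$ of $D$ contains a vertex $v$ with $\min\{d^+_{D'}(v),d^-_{D'}(v)\}<s$. A $p$-partition of $D$ is a sequence $(D_1,\dots,D_p)$ of pairwise disjoint (possibly empty) induced subdigraphs of $D$ with $V(D)=V(D_1)\cup\dots\cup V(D_p)$. The $s$-degenerate dichromatic number $\overrightarrow{\chi}_s(D)$ is the least integer $p$ such that $D$ has a $p$-partition into weakly $s$-degenerate subdigraphs. A bidirected graph is a digraph obtained from a simple undirected graph by replacing each edge by two opposite arcs. A digraph is Eulerian if $d_D^+(v)=d_D^-(v)$ for every vertex $v$. **Theorem.** Let $D$ be a connected digraph, let $m=\max_{v\in V(D)}\max\{d_D^+(v),d_D^-(v)\}$, let $s\ge 1$ be an integer, and let $p=\lceil m/s\rceil$. Suppose that $D$ is neither a bidirected cycle of odd length (at least $3$), nor a bidirected complete graph, nor an Eulerian digraph in which every vertex has in-degree and out-degree $s$. Then $D$ has a $p$-partition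 into weakly $s$-degenerate induced subdigraphs; that is, $\overrightarrow{\chi}_s(D)\le p$. -/

import Mathlib

namespace Digraph

variable {V : Type*}

/-- The number of arcs of `D` with initial vertex `v` (used for finite digraphs only). -/
noncomputable def outDegree (D : Digraph V) (v : V) : ℕ := {w | D.Adj v w}.ncard

/-- The number of arcs of `D` with terminal vertex `v` (used for finite digraphs only). -/
noncomputable def inDegree (D : Digraph V) (v : V) : ℕ := {w | D.Adj w v}.ncard

/-- The maximum of all out-degrees and in-degrees of a finite digraph. -/
noncomputable def maxSemidegree [Fintype V] (D : Digraph V) : ℕ :=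
  Finset.univ.sup fun v => max (D.outDegree v) (D.inDegree v)

/-- `D` has no loops. Parallel arcs do not exist for `Digraph`; opposite arcs are allowed. -/
def Loopless (D : Digraph V) : Prop := ∀ v, ¬ D.Adj v v

/-- `D` is connected if its underlying undirected graph is (in particular, `V` is non-empty). -/
def IsConnected (D : Digraph V) : Prop := D.toSimpleGraphInclusive.Connected

/-- Every vertex has the same out-degree and in-degree. -/
def IsEulerian (D : Digraph V) : Prop := ∀ v, D.outDegree v = D.inDegree v

/-- The bidirected graph of `G`: every edge is replaced by two opposite arcs. -/
def bidirected (G : SimpleGraph V) : Digraph V := ⟨G.Adj⟩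

/-- `D` is a bidirected complete graph. -/
def IsBidirectedComplete (D : Digraph V) : Prop := D = bidirected (⊤ : SimpleGraph V)

/-- `D` is the bidirected graph of a cycle of odd length. -/
def IsBidirectedOddCycle (D : Digraph V) : Prop :=
  ∃ (G : SimpleGraph V) (n : ℕ), D = bidirected G ∧ 3 ≤ n ∧ Odd n ∧
    Nonempty (G ≃g SimpleGraph.cycleGraph n)

/-- A subdigraph of `D`: a set of vertices and a set of arcs of `D` between them. -/
structure Subdigraph (D : Digraph V) where
  verts : Set V
  Adj : V → V → Prop
  adj_sub : ∀ {u v : V}, Adj u v → D.Adj u v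
  initial_mem : ∀ {u v : V}, Adj u v → u ∈ verts
  terminal_mem : ∀ {u v : V}, Adj u v → v ∈ verts

namespace Subdigraph

variable {D : Digraph V}

/-- The out-degree of `v` in the subdigraph `H`. -/
noncomputable def outDegree (H : D.Subdigraph) (v : V) : ℕ := {w | H.Adj v w}.ncard

/-- The in-degree of `v` in the subdigraph `H`. -/
noncomputable def inDegree (H : D.Subdigraph) (v : V) : ℕ := {w | H.Adj w v}.ncard

end Subdigraph

/-- Every non-empty subdigraph has a vertex whose out-degree or in-degree in it is less
than `s`. -/
def WeaklyDegenerate (D : Digraph V) (s : ℕ) : Prop :=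
  ∀ H : D.Subdigraph, H.verts.Nonempty →
    ∃ v ∈ H.verts, min (H.outDegree v) (H.inDegree v) < s

/-- The subdigraph of `D` induced by `X`, as a digraph with vertex set `X`. -/
def induce (D : Digraph V) (X : Set V) : Digraph X := ⟨fun u v => D.Adj u v⟩

/-- `D` has a partition into `p` (possibly empty) induced subdigraphs
`D[X 0], …, D[X (p - 1)]`, each of which is weakly `s`-degenerate. -/
def HasDegeneratePartition (D : Digraph V) (s p : ℕ) : Prop :=
  ∃ X : Fin p → Set V, Pairwise (fun i j => Disjoint (X i) (X j)) ∧ (⋃ i, X i) = Set.univ ∧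
    ∀ i, (D.induce (X i)).WeaklyDegenerate s

/-- The `s`-degenerate dichromatic number: the least `p` such that `D` has a `p`-partition into
weakly `s`-degenerate induced subdigraphs (`⊤` if there is none). -/
noncomputable def degenerateDichromaticNumber (D : Digraph V) (s : ℕ) : ℕ∞ :=
  ⨅ (p : ℕ) (_ : D.HasDegeneratePartition s p), (p : ℕ∞)

end Digraph

namespace Digraph

variable {V : Type*}

/-! Suppose that no partition exists. Every vertex v still admits a near colouring: all vertices
except v are coloured and every class is weakly s-degenerate; the value at v is ignored
(`exists_coloring_off`). As v cannot be coloured, each colour occurs at least s times among its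
out-neighbours and among its in-neighbours; as degrees are at most ps, it occurs exactly s times
(`ncard_color`). This rigidity lets the uncoloured vertex move to any neighbour, like the gap in a
sliding puzzle (`move`).

Carry the gap once around a cycle through v on which v has no chord. The colours of the other cycle
vertices rotate and everything off the cycle stays fixed. Counting colours around v before and after
gives `ring_dichotomy`: either every near colouring is constant on the rest of the cycle, or the
colours there have cyclic period two and both cycle edges at v carry the same arc directions.

Let p ≥ 2 and let v be a non-cut vertex. If some near colouring puts two colours on a triangle at v,
a maximal clique containing it absorbs all neighbours of v and turns out to be bidirected and all of
D. Otherwise, a shortest path avoiding v between differently coloured neighbours of v closes up to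
an induced cycle. Its colours alternate, so its length is odd; v has no further neighbours, so ps =
2, and D is this cycle, bidirected. The cases p = 0 and p = 1 give a single vertex and the s-regular
exception. -/

/-- Every nonempty set of vertices inside `X` contains a vertex having, inside that set, fewer
than `s` out-neighbours or fewer than `s` in-neighbours. -/
def DegenerateOn (D : Digraph V) (s : ℕ) (X : Set V) : Prop :=
  ∀ H ⊆ X, H.Nonempty → ∃ v ∈ H,
    {w | D.Adj v w ∧ w ∈ H}.ncard < s ∨ {w | D.Adj w v ∧ w ∈ H}.ncard < s

/-- `f` colours all vertices but `v` such that all colour classes are weakly `s`-degenerate. -/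
def NearColoring (D : Digraph V) (s : ℕ) {p : ℕ} (v : V) (f : V → Fin p) : Prop :=
  ∀ i, D.DegenerateOn s {u | u ≠ v ∧ f u = i}

/-- A loopless connected digraph with all semidegrees at most `p * s` that has no partition into
`p` weakly `s`-degenerate parts. -/
structure IsObstruction (D : Digraph V) (s p : ℕ) : Prop where
  loopless : D.Loopless
  connected : D.IsConnected
  out_le : ∀ v, {w | D.Adj v w}.ncard ≤ p * s
  in_le : ∀ v, {w | D.Adj w v}.ncard ≤ p * s
  not_colorable : ¬ ∃ f : V → Fin p, ∀ i, D.DegenerateOn s {u | f u = i}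

/-- The underlying undirected graph. -/
abbrev under (D : Digraph V) : SimpleGraph V := D.toSimpleGraphInclusive

theorem under_adj {D : Digraph V} {a b : V} :
    D.under.Adj a b ↔ a ≠ b ∧ (D.Adj a b ∨ D.Adj b a) := SimpleGraph.fromRel_adj _ _ _

theorem Loopless.under_adj {D : Digraph V} (h : D.Loopless) {a b : V} :
    D.under.Adj a b ↔ D.Adj a b ∨ D.Adj b a := by
  rw [Digraph.under_adj]
  refine ⟨fun h => h.2, fun h' => ⟨?_, h'⟩⟩
  rintro rfl
  exact h _ (by tauto)

/-! ### Weakly degenerate vertex sets and greedy colouring -/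

theorem DegenerateOn.mono {D : Digraph V} {s : ℕ} {X Y : Set V} (h : D.DegenerateOn s Y)
    (hXY : X ⊆ Y) : D.DegenerateOn s X := fun H hH hne => h H (hH.trans hXY) hne

theorem DegenerateOn.insert [Finite V] {D : Digraph V} (hl : D.Loopless) {s : ℕ} {X : Set V}
    (h : D.DegenerateOn s X) {u : V}
    (hu : {w | D.Adj u w ∧ w ∈ X}.ncard < s ∨ {w | D.Adj w u ∧ w ∈ X}.ncard < s) :
    D.DegenerateOn s (insert u X) := by
  intro H hH hne
  by_cases huH : u ∈ H
  · refine ⟨u, huH, hu.imp (fun h => lt_of_le_of_lt (Set.ncard_le_ncard ?_) h)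
      (fun h => lt_of_le_of_lt (Set.ncard_le_ncard ?_) h)⟩ <;>
    · rintro w ⟨hw, hwH⟩
      refine ⟨hw, (hH hwH).resolve_left ?_⟩
      rintro rfl
      exact hl _ hw
  · refine h H (fun w hw => (hH hw).resolve_left ?_) hne
    rintro rfl
    exact huH hw

theorem degenerateOn_empty (D : Digraph V) (s : ℕ) : D.DegenerateOn s ∅ := by
  intro H hH hne
  obtain ⟨x, hx⟩ := hne
  exact (hH hx).elim

/-- Testing vertex sets suffices, since deleting arcs only lowers degrees. -/
theorem DegenerateOn.weaklyDegenerate_induce [Finite V] {D : Digraph V} {s : ℕ} {X : Set V}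
    (h : D.DegenerateOn s X) : (D.induce X).WeaklyDegenerate s := by
  intro H hne
  obtain ⟨v, ⟨⟨v', hv'⟩, hvH, rfl⟩, hv⟩ := h (Subtype.val '' H.verts)
    (by rintro _ ⟨x, -, rfl⟩; exact x.2) (hne.image _)
  refine ⟨⟨v', hv'⟩, hvH, min_lt_iff.2 (hv.imp (fun h => lt_of_le_of_lt ?_ h)
      (fun h => lt_of_le_of_lt ?_ h))⟩
  · unfold Subdigraph.outDegree
    rw [← Set.ncard_image_of_injective _ Subtype.val_injective]
    refine Set.ncard_le_ncard ?_
    rintro _ ⟨w, hw, rfl⟩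
    exact ⟨H.adj_sub hw, ⟨w, H.terminal_mem hw, rfl⟩⟩
  · unfold Subdigraph.inDegree
    rw [← Set.ncard_image_of_injective _ Subtype.val_injective]
    refine Set.ncard_le_ncard ?_
    rintro _ ⟨w, hw, rfl⟩
    exact ⟨H.adj_sub hw, ⟨w, H.initial_mem hw, rfl⟩⟩

theorem hasDegeneratePartition_of_coloring [Finite V] {D : Digraph V} {s p : ℕ} {f : V → Fin p}
    (h : ∀ i, D.DegenerateOn s {u | f u = i}) : D.HasDegeneratePartition s p := by
  refine ⟨fun i => {u | f u = i}, ?_, ?_, fun i => (h i).weaklyDegenerate_induce⟩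
  · intro i j hij
    rw [Set.disjoint_left]
    rintro u rfl hj
    exact hij hj
  · ext u
    simp

/-- The sizes of the colour classes of a set add up. -/
theorem ncard_eq_sum_ncard_color [Finite V] {p : ℕ} (f : V → Fin p) (S : Set V) :
    S.ncard = ∑ i, {w | w ∈ S ∧ f w = i}.ncard := by
  classical
  have := Fintype.ofFinite V
  simp only [Set.ncard_eq_toFinset_card']
  rw [Finset.card_eq_sum_card_fiberwise (f := f) (t := Finset.univ) (by simp)]
  refine Finset.sum_congr rfl fun i _ => ?_
  congr 1
  ext w
  simp

theorem exists_color_lt [Finite V] {s p : ℕ} (f : V → Fin p) {S : Set V} (h : S.ncard < p * s) :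
    ∃ i, {w | w ∈ S ∧ f w = i}.ncard < s := by
  by_contra! hc
  have := Finset.sum_le_sum fun i (_ : i ∈ Finset.univ) => hc i
  rw [← ncard_eq_sum_ncard_color f S] at this
  simp at this
  omega

/-- Every connected graph has an edge leaving any proper nonempty set of vertices. -/
theorem _root_.SimpleGraph.Connected.exists_adj_mem_notMem {G : SimpleGraph V} (hG : G.Connected)
    {S : Set V} {a b : V} (ha : a ∈ S) (hb : b ∉ S) : ∃ x ∈ S, ∃ y ∉ S, G.Adj x y := by
  obtain ⟨w⟩ := hG.preconnected a b
  obtain ⟨d, -, h1, h2⟩ := w.exists_boundary_dart S ha hb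
  exact ⟨_, h1, _, h2, d.adj⟩

/-- Greedy colouring towards the root `r`: by connectivity some `x` in `S` has a neighbour outside
`S`. Colour the rest of `S` first; then `x` sees fewer than ps coloured vertices in one direction,
and by pigeonhole some colour is free for it. -/
theorem exists_coloring_off [Finite V] {D : Digraph V} (hl : D.Loopless) (hc : D.IsConnected)
    {s p : ℕ} (hp : 0 < p) (ho : ∀ v, {w | D.Adj v w}.ncard ≤ p * s)
    (hi : ∀ v, {w | D.Adj w v}.ncard ≤ p * s) (r : V) (n : ℕ) :
    ∀ S : Set V, S.ncard = n → r ∉ S →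
      ∃ f : V → Fin p, ∀ i, D.DegenerateOn s {u | u ∈ S ∧ f u = i} := by
  classical
  induction n with
  | zero =>
    intro S hS _
    rw [Set.ncard_eq_zero] at hS
    subst hS
    exact ⟨fun _ => ⟨0, hp⟩, fun i => (degenerateOn_empty D s).mono (by simp)⟩
  | succ n ih =>
    intro S hS hr
    obtain ⟨a, ha⟩ := Set.nonempty_of_ncard_ne_zero (s := S) (by omega)
    obtain ⟨x, hx, y, hy, hxy⟩ := SimpleGraph.Connected.exists_adj_mem_notMem hc ha hr
    obtain ⟨f, hf⟩ := ih (S \ {x}) (by rw [Set.ncard_sdiff_singleton_of_mem hx]; omega)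
      (fun h => hr h.1)
    have key : ∃ i, {w | D.Adj x w ∧ w ∈ S \ {x} ∧ f w = i}.ncard < s ∨
        {w | D.Adj w x ∧ w ∈ S \ {x} ∧ f w = i}.ncard < s := by
      rcases hl.under_adj.1 hxy with h | h
      · have : {w | D.Adj x w ∧ w ∈ S \ {x}}.ncard < p * s :=
          lt_of_lt_of_le (Set.ncard_lt_ncard ⟨fun w hw => hw.1, fun hh => hy (hh h).2.1⟩) (ho x)
        obtain ⟨i, hi⟩ := exists_color_lt f this
        exact ⟨i, Or.inl (by simpa [and_assoc] using hi)⟩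
      · have : {w | D.Adj w x ∧ w ∈ S \ {x}}.ncard < p * s :=
          lt_of_lt_of_le (Set.ncard_lt_ncard ⟨fun w hw => hw.1, fun hh => hy (hh h).2.1⟩) (hi x)
        obtain ⟨i, hi⟩ := exists_color_lt f this
        exact ⟨i, Or.inr (by simpa [and_assoc] using hi)⟩
    obtain ⟨i, hi⟩ := key
    refine ⟨Function.update f x i, fun j => ?_⟩
    by_cases hj : j = i
    · subst hj
      refine (DegenerateOn.insert hl (hf j) hi).mono ?_
      rintro u ⟨hu, huj⟩
      by_cases hux : u = x
      · exact Or.inl hux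
      · exact Or.inr ⟨⟨hu, hux⟩, by simpa [hux] using huj⟩
    · refine (hf j).mono ?_
      rintro u ⟨hu, huj⟩
      by_cases hux : u = x
      · subst hux
        simp only [Function.update_self] at huj
        exact absurd huj.symm hj
      · exact ⟨⟨hu, hux⟩, by simpa [hux] using huj⟩

/-! ### Rigidity of near colourings -/

namespace IsObstruction

variable [Finite V] {D : Digraph V} {s p : ℕ}

theorem exists_nearColoring (h : D.IsObstruction s p) (hp : 0 < p) (v : V) :
    ∃ f : V → Fin p, D.NearColoring s v f := by
  obtain ⟨f, hf⟩ := exists_coloring_off h.loopless h.connected hp h.out_le h.in_le v _ {v}ᶜ rfl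
    (by simp)
  exact ⟨f, fun i => (hf i).mono fun u hu => hu⟩

/-- Otherwise `v` could take colour `i`, which would complete the colouring. -/
theorem le_ncard_color (h : D.IsObstruction s p) {v : V} {f : V → Fin p}
    (hf : D.NearColoring s v f) (i : Fin p) :
    s ≤ {w | D.Adj v w ∧ f w = i}.ncard ∧ s ≤ {w | D.Adj w v ∧ f w = i}.ncard := by
  classical
  by_contra hc
  rw [not_and_or, not_le, not_le] at hc
  refine h.not_colorable ⟨Function.update f v i, fun j => ?_⟩
  by_cases hj : j = i
  · subst hj
    refine (DegenerateOn.insert h.loopless (hf j) (u := v)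
      (hc.imp (fun h => lt_of_le_of_lt (Set.ncard_le_ncard ?_) h)
        (fun h => lt_of_le_of_lt (Set.ncard_le_ncard ?_) h))).mono ?_
    · exact fun w hw => ⟨hw.1, hw.2.2⟩
    · exact fun w hw => ⟨hw.1, hw.2.2⟩
    · intro u hu
      by_cases huv : u = v
      · exact Or.inl huv
      · exact Or.inr ⟨huv, by simpa [huv] using hu⟩
  · refine (hf j).mono fun u hu => ?_
    have huv : u ≠ v := by
      rintro rfl
      simp only [Set.mem_ofPred_eq, Function.update_self] at hu
      exact hj hu.symm
    exact ⟨huv, by simpa [huv] using hu⟩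

theorem ncard_adj (h : D.IsObstruction s p) (hp : 0 < p) (v : V) :
    {w | D.Adj v w}.ncard = p * s ∧ {w | D.Adj w v}.ncard = p * s := by
  obtain ⟨f, hf⟩ := h.exists_nearColoring hp v
  constructor
  · refine le_antisymm (h.out_le v) ?_
    have := Finset.sum_le_sum fun i (_ : i ∈ Finset.univ) => (h.le_ncard_color hf i).1
    rw [ncard_eq_sum_ncard_color f]
    simpa using this
  · refine le_antisymm (h.in_le v) ?_
    have := Finset.sum_le_sum fun i (_ : i ∈ Finset.univ) => (h.le_ncard_color hf i).2
    rw [ncard_eq_sum_ncard_color f]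
    simpa using this

/-- One surplus neighbour in some colour would push the degree above ps. -/
theorem ncard_color (h : D.IsObstruction s p) {v : V} {f : V → Fin p}
    (hf : D.NearColoring s v f) (i : Fin p) :
    {w | D.Adj v w ∧ f w = i}.ncard = s ∧ {w | D.Adj w v ∧ f w = i}.ncard = s := by
  constructor
  · refine le_antisymm ?_ (h.le_ncard_color hf i).1
    by_contra! hc
    have := Finset.sum_lt_sum (fun i (_ : i ∈ Finset.univ) => (h.le_ncard_color hf i).1)
      ⟨i, Finset.mem_univ _, hc⟩
    have h2 := ncard_eq_sum_ncard_color f {w | D.Adj v w}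
    have h3 := h.out_le v
    simp at this h2
    omega
  · refine le_antisymm ?_ (h.le_ncard_color hf i).2
    by_contra! hc
    have := Finset.sum_lt_sum (fun i (_ : i ∈ Finset.univ) => (h.le_ncard_color hf i).2)
      ⟨i, Finset.mem_univ _, hc⟩
    have h2 := ncard_eq_sum_ncard_color f {w | D.Adj w v}
    have h3 := h.in_le v
    simp at this h2
    omega

/-- The uncoloured vertex may be moved to any neighbour. -/
theorem move (h : D.IsObstruction s p) {v w : V} {f : V → Fin p} (hf : D.NearColoring s v f)
    (hvw : D.under.Adj v w) :
    ∃ g : V → Fin p, D.NearColoring s w g ∧ g v = f w ∧ ∀ u, u ≠ v → g u = f u := by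
  classical
  refine ⟨Function.update f v (f w), fun i => ?_, by simp, fun u hu => by simp [hu]⟩
  by_cases hi : i = f w
  · have hd : D.DegenerateOn s {u | u ≠ v ∧ u ≠ w ∧ f u = i} :=
      (hf i).mono fun u hu => ⟨hu.1, hu.2.2⟩
    refine (DegenerateOn.insert h.loopless hd (u := v) ?_).mono ?_
    -- Once `w` loses its colour, `v` has only s - 1 neighbours of that colour in the direction of
    -- the arc joining it to `w`.
    · rcases h.loopless.under_adj.1 hvw with hh | hh
      · left
        rw [← (h.ncard_color hf i).1]
        exact Set.ncard_lt_ncard ⟨fun u hu => ⟨hu.1, hu.2.2.2⟩,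
          fun hs => (hs ⟨hh, hi.symm⟩ : _ ∧ _ ∧ w ≠ w ∧ _).2.2.1 rfl⟩
      · right
        rw [← (h.ncard_color hf i).2]
        exact Set.ncard_lt_ncard ⟨fun u hu => ⟨hu.1, hu.2.2.2⟩,
          fun hs => (hs ⟨hh, hi.symm⟩ : _ ∧ _ ∧ w ≠ w ∧ _).2.2.1 rfl⟩
    · rintro u ⟨huw, hu⟩
      by_cases huv : u = v
      · exact Or.inl huv
      · exact Or.inr ⟨huv, huw, by simpa [huv] using hu⟩
  · refine (hf i).mono ?_
    rintro u ⟨huw, hu⟩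
    have huv : u ≠ v := by
      rintro rfl
      simp only [Function.update_self] at hu
      exact hi hu.symm
    exact ⟨huv, by simpa [huv] using hu⟩

end IsObstruction

/-! ### Rings and the rotation of their colours -/

/-- The vertices `v, w 0, …, w (k - 1)` form, in this order, a cycle of the underlying graph, and
`v` has no neighbours on this cycle apart from `w 0` and `w (k - 1)`. -/
structure IsRing (D : Digraph V) (v : V) (w : ℕ → V) (k : ℕ) : Prop where
  two_le : 2 ≤ k
  adj : ∀ i, i + 1 < k → D.under.Adj (w i) (w (i + 1))
  inj : ∀ i < k, ∀ j < k, w i = w j → i = j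
  ne : ∀ i < k, w i ≠ v
  adj_first : D.under.Adj v (w 0)
  adj_last : D.under.Adj v (w (k - 1))
  not_adj : ∀ i, 0 < i → i + 1 < k → ¬ D.under.Adj v (w i)

theorem IsRing.reverse {D : Digraph V} {v : V} {w : ℕ → V} {k : ℕ} (hr : D.IsRing v w k) :
    D.IsRing v (fun i => w (k - 1 - i)) k where
  two_le := hr.two_le
  adj i hi := by
    have := hr.adj (k - 1 - (i + 1)) (by omega)
    rw [show k - 1 - (i + 1) + 1 = k - 1 - i by omega] at this
    exact this.symm
  inj i hi j hj h := by
    have := hr.inj _ (by omega) _ (by omega) h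
    omega
  ne i hi := hr.ne _ (by omega)
  adj_first := hr.adj_last
  adj_last := by simpa using hr.adj_first
  not_adj i h0 hi := hr.not_adj _ (by omega) (by omega)

section Count

variable [Finite V] {p s : ℕ} {S : Set V} {f g : V → Fin p} {a b : V}

/-- Equal colour counts on `S` leave no freedom at a single vertex; for two vertices, the next lemma
says that the pair of colours is preserved. Here `S` will be an out- or in-neighbourhood of the
uncoloured vertex. -/
theorem color_eq_of_agree (hf : ∀ i, {u | u ∈ S ∧ f u = i}.ncard = s)
    (hg : ∀ i, {u | u ∈ S ∧ g u = i}.ncard = s) (ha : a ∈ S)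
    (hfg : ∀ u ∈ S, u ≠ a → f u = g u) : f a = g a := by
  by_contra hne
  have : {u | u ∈ S ∧ f u = f a} = insert a {u | u ∈ S ∧ g u = f a} := by
    ext u
    by_cases hu : u = a
    · subst hu; simp [ha]
    · simp only [Set.mem_ofPred_eq, Set.mem_insert_iff, hu, false_or]
      exact and_congr_right fun huS => by rw [hfg u huS hu]
  have h1 := hf (f a)
  rw [this, Set.ncard_insert_of_notMem (by simp [Ne.symm hne]), hg] at h1
  omega

theorem color_eq_of_agree_pair (hf : ∀ i, {u | u ∈ S ∧ f u = i}.ncard = s)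
    (hg : ∀ i, {u | u ∈ S ∧ g u = i}.ncard = s) (ha : a ∈ S) (hb : b ∈ S)
    (hfg : ∀ u ∈ S, u ≠ a → u ≠ b → f u = g u) (hba : g b = f a) : g a = f b := by
  by_cases hab : f a = f b
  · rw [← color_eq_of_agree hf hg ha, hab]
    intro u hu hua
    by_cases hub : u = b
    · rw [hub, hba, hab]
    · exact hfg u hu hua hub
  by_contra hne
  have : {u | u ∈ S ∧ f u = f b} = insert b {u | u ∈ S ∧ g u = f b} := by
    ext u
    by_cases hub : u = b
    · subst hub; simp [hb]
    by_cases hua : u = a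
    · subst hua; simp [hab, hub, hne]
    · simp only [Set.mem_ofPred_eq, Set.mem_insert_iff, hub, false_or]
      exact and_congr_right fun huS => by rw [hfg u huS hua hub]
  have h1 := hf (f b)
  rw [this, Set.ncard_insert_of_notMem (by simp [hba, hab]), hg] at h1
  omega

end Count

namespace IsObstruction

variable [Finite V] {D : Digraph V} {s p : ℕ}

/-- Sliding the uncoloured vertex along a path. -/
theorem slide (h : D.IsObstruction s p) {v : V} {f : V → Fin p} (hf : D.NearColoring s v f)
    {w : ℕ → V} {k : ℕ} (h0 : D.under.Adj v (w 0))
    (hadj : ∀ i, i + 1 < k → D.under.Adj (w i) (w (i + 1)))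
    (hinj : ∀ i < k, ∀ j < k, w i = w j → i = j) (hne : ∀ i < k, w i ≠ v) (j : ℕ) (hj : j < k) :
    ∃ g : V → Fin p, D.NearColoring s (w j) g ∧ g v = f (w 0) ∧
      (∀ i < j, g (w i) = f (w (i + 1))) ∧
      ∀ u, u ≠ v → (∀ i ≤ j, u ≠ w i) → g u = f u := by
  induction j with
  | zero =>
    obtain ⟨g, hg, hgv, hgu⟩ := h.move hf h0
    exact ⟨g, hg, hgv, by simp, fun u hu _ => hgu u hu⟩
  | succ j ih =>
    obtain ⟨g, hg, hgv, hgi, hgu⟩ := ih (by omega)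
    obtain ⟨g', hg', hgj', hgu'⟩ := h.move hg (hadj j hj)
    refine ⟨g', hg', ?_, ?_, ?_⟩
    · rw [hgu' _ (hne j (by omega)).symm, hgv]
    · intro i hi
      by_cases hij : i = j
      · subst hij
        rw [hgj', hgu _ (hne _ hj)]
        intro l hl hll
        have := hinj _ hj _ (by omega) hll
        omega
      · rw [hgu' _ (fun hh => hij (hinj _ (by omega) _ (by omega) hh)), hgi i (by omega)]
    · intro u huv hu
      rw [hgu' u (hu j (by omega)), hgu u huv fun i hi => hu i (by omega)]

/-- Moving the uncoloured vertex once around a ring rotates the colours of the ring. -/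
theorem rotate (h : D.IsObstruction s p) {v : V} {f : V → Fin p} (hf : D.NearColoring s v f)
    {w : ℕ → V} {k : ℕ} (hr : D.IsRing v w k) :
    ∃ g : V → Fin p, D.NearColoring s v g ∧ (∀ i < k, g (w i) = f (w ((i + 1) % k))) ∧
      ∀ u, u ≠ v → (∀ i < k, u ≠ w i) → g u = f u := by
  have hk := hr.two_le
  obtain ⟨g, hg, hgv, hgi, hgu⟩ :=
    h.slide hf hr.adj_first hr.adj hr.inj hr.ne (k - 1) (by omega)
  obtain ⟨g', hg', hgj', hgu'⟩ := h.move hg hr.adj_last.symm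
  refine ⟨g', hg', ?_, ?_⟩
  · intro i hi
    by_cases hik : i = k - 1
    · subst hik
      rw [hgj', hgv, show k - 1 + 1 = k by omega, Nat.mod_self]
    · rw [hgu' _ (fun hh => hik (hr.inj _ hi _ (by omega) hh)), hgi i (by omega),
        Nat.mod_eq_of_lt (by omega)]
  · intro u huv hu
    rw [hgu' u (hu _ (by omega)), hgu u huv fun i hi => hu i (by omega)]

theorem rotate_iterate (h : D.IsObstruction s p) {v : V} {f : V → Fin p}
    (hf : D.NearColoring s v f) {w : ℕ → V} {k : ℕ} (hr : D.IsRing v w k) (r : ℕ) :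
    ∃ g : V → Fin p, D.NearColoring s v g ∧ ∀ i < k, g (w i) = f (w ((i + r) % k)) := by
  induction r with
  | zero => exact ⟨f, hf, fun i hi => by rw [Nat.add_zero, Nat.mod_eq_of_lt hi]⟩
  | succ r ih =>
    obtain ⟨g, hg, hgi⟩ := ih
    obtain ⟨g', hg', hgi', -⟩ := h.rotate hg hr
    refine ⟨g', hg', fun i hi => ?_⟩
    rw [hgi' i hi, hgi _ (Nat.mod_lt _ (by omega)), Nat.mod_add_mod]
    congr 3
    omega

theorem ring_monochromatic (h : D.IsObstruction s p) {v : V} {w : ℕ → V} {k : ℕ}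
    (hr : D.IsRing v w k)
    (hc : ∀ f : V → Fin p, D.NearColoring s v f → f (w (k - 1)) = f (w 0)) :
    ∀ f : V → Fin p, D.NearColoring s v f → ∀ i < k, ∀ j < k, f (w i) = f (w j) := by
  intro f hf
  have hk := hr.two_le
  have key : ∀ i < k, f (w i) = f (w 0) := by
    intro i
    induction i with
    | zero => intro _; rfl
    | succ i ih =>
      intro hi
      -- After i + 1 rotations, positions k - 1 and 0 carry the former colours of positions i and i
      -- + 1.
      obtain ⟨g, hg, hgi⟩ := h.rotate_iterate hf hr (i + 1)
      have := hc g hg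
      rw [hgi _ (by omega), hgi _ (by omega), show k - 1 + (i + 1) = i + k by omega,
        Nat.add_mod_right, Nat.mod_eq_of_lt (by omega), Nat.zero_add, Nat.mod_eq_of_lt hi] at this
      rw [← this, ih (by omega)]
  intro i hi j hj
  rw [key i hi, key j hj]

/-- Either all near colourings are monochromatic on a ring, or both edges of the ring at `v` are of
the same kind and the colours have period two. -/
theorem ring_dichotomy (h : D.IsObstruction s p) {v : V} {w : ℕ → V} {k : ℕ}
    (hr : D.IsRing v w k) :
    ((D.Adj v (w 0) ↔ D.Adj v (w (k - 1))) ∧ (D.Adj (w 0) v ↔ D.Adj (w (k - 1)) v) ∧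
      ∀ f : V → Fin p, D.NearColoring s v f → ∀ i < k, f (w i) = f (w ((i + 2) % k))) ∨
    ∀ f : V → Fin p, D.NearColoring s v f → ∀ i < k, ∀ j < k, f (w i) = f (w j) := by
  have hk := hr.two_le
  have agree : ∀ f g : V → Fin p, (∀ u, u ≠ v → (∀ i < k, u ≠ w i) → g u = f u) →
      ∀ u, D.under.Adj v u → u ≠ w 0 → u ≠ w (k - 1) → f u = g u := by
    intro f g hgu u huv h0 h1
    refine (hgu u huv.ne' ?_).symm
    rintro i hi rfl
    refine hr.not_adj i (Nat.pos_of_ne_zero ?_) ?_ huv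
    · rintro rfl
      exact h0 rfl
    · by_contra hh
      exact h1 (by rw [show i = k - 1 by omega])
  -- the consequences of counting the neighbours in a set `S` of neighbours of `v`
  have count : ∀ S : Set V, (∀ u ∈ S, D.under.Adj v u) →
      (∀ f : V → Fin p, D.NearColoring s v f → ∀ i, {u | u ∈ S ∧ f u = i}.ncard = s) →
      (w 0 ∈ S ∨ w (k - 1) ∈ S) →
      ((w 0 ∈ S ∧ w (k - 1) ∈ S) ∧
        ∀ f : V → Fin p, D.NearColoring s v f → f (w (k - 1)) = f (w 1)) ∨
      (¬ (w 0 ∈ S ∧ w (k - 1) ∈ S) ∧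
        ∀ f : V → Fin p, D.NearColoring s v f → ∀ i < k, ∀ j < k, f (w i) = f (w j)) := by
    intro S hS hcard hor
    have key : ∀ f : V → Fin p, D.NearColoring s v f → ∃ g : V → Fin p, D.NearColoring s v g ∧
        g (w 0) = f (w 1) ∧ g (w (k - 1)) = f (w 0) ∧
        ∀ u ∈ S, u ≠ w 0 → u ≠ w (k - 1) → f u = g u := by
      intro f hf
      obtain ⟨g, hg, hgi, hgu⟩ := h.rotate hf hr
      refine ⟨g, hg, ?_, ?_, fun u hu => agree f g hgu u (hS u hu)⟩
      · rw [hgi 0 (by omega), Nat.zero_add, Nat.mod_eq_of_lt (by omega)]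
      · rw [hgi _ (by omega), show k - 1 + 1 = k by omega, Nat.mod_self]
    -- A rotation gives the ends `w 0`, `w (k - 1)` the colours of `w 1`, `w 0` and changes no other
    -- colour in `S`. If both ends lie in `S`, comparing pairs yields equal colours at `w (k - 1)`
    -- and `w 1`; if only one does, two cyclically consecutive colours agree in every near
    -- colouring.
    by_cases h0 : w 0 ∈ S <;> by_cases h1 : w (k - 1) ∈ S
    · refine Or.inl ⟨⟨h0, h1⟩, fun f hf => ?_⟩
      obtain ⟨g, hg, hg0, hg1, hgu⟩ := key f hf
      rw [← hg0]
      exact (color_eq_of_agree_pair (hcard f hf) (hcard g hg) h0 h1 hgu hg1).symm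
    · refine Or.inr ⟨fun hh => h1 hh.2, ?_⟩
      have step : ∀ f : V → Fin p, D.NearColoring s v f → f (w 0) = f (w 1) := by
        intro f hf
        obtain ⟨g, hg, hg0, hg1, hgu⟩ := key f hf
        rw [← hg0]
        refine color_eq_of_agree (hcard f hf) (hcard g hg) h0 fun u hu hu0 => hgu u hu hu0 ?_
        rintro rfl
        exact h1 hu
      refine h.ring_monochromatic hr fun f hf => ?_
      obtain ⟨g, hg, hgi⟩ := h.rotate_iterate hf hr (k - 1)
      have := step g hg
      rwa [hgi _ (by omega), hgi _ (by omega), Nat.zero_add, Nat.mod_eq_of_lt (by omega),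
        show 1 + (k - 1) = k by omega, Nat.mod_self] at this
    · refine Or.inr ⟨fun hh => h0 hh.1, ?_⟩
      refine h.ring_monochromatic hr fun f hf => ?_
      obtain ⟨g, hg, hg0, hg1, hgu⟩ := key f hf
      rw [← hg1]
      refine color_eq_of_agree (hcard f hf) (hcard g hg) h1 fun u hu hu0 => hgu u hu ?_ hu0
      rintro rfl
      exact h0 hu
    · tauto
  have period : (∀ f : V → Fin p, D.NearColoring s v f → f (w (k - 1)) = f (w 1)) →
      ∀ f : V → Fin p, D.NearColoring s v f → ∀ i < k, f (w i) = f (w ((i + 2) % k)) := by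
    intro hc f hf i hi
    obtain ⟨g, hg, hgi⟩ := h.rotate_iterate hf hr (i + 1)
    have := hc g hg
    rwa [hgi _ (by omega), hgi _ (by omega), show k - 1 + (i + 1) = i + k by omega,
      Nat.add_mod_right, Nat.mod_eq_of_lt hi, show 1 + (i + 1) = i + 2 by omega] at this
  have hout := count {u | D.Adj v u} (fun u hu => h.loopless.under_adj.2 (Or.inl hu))
    (fun f hf i => (h.ncard_color hf i).1)
  have hin := count {u | D.Adj u v} (fun u hu => h.loopless.under_adj.2 (Or.inr hu))
    (fun f hf i => (h.ncard_color hf i).2)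
  have ha := h.loopless.under_adj.1 hr.adj_first
  simp only [Set.mem_ofPred_eq] at hout hin
  by_cases hmono :
      ∀ f : V → Fin p, D.NearColoring s v f → ∀ i < k, ∀ j < k, f (w i) = f (w j)
  · exact Or.inr hmono
  simp only [hmono, and_false, or_false] at hout hin
  refine Or.inl ⟨⟨fun hh => (hout (Or.inl hh)).1.2, fun hh => (hout (Or.inr hh)).1.1⟩,
    ⟨fun hh => (hin (Or.inl hh)).1.2, fun hh => (hin (Or.inr hh)).1.1⟩, period ?_⟩
  rcases ha with ha | ha
  · exact (hout (Or.inl ha)).2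
  · exact (hin (Or.inl ha)).2

/-- Two near colourings cannot differ exactly on an initial segment of a ring of length at least
four. -/
theorem false_of_ring_of_differ (h : D.IsObstruction s p) {v : V} {w : ℕ → V} {k : ℕ}
    (hr : D.IsRing v w k) (hk : 3 ≤ k) {f g : V → Fin p} (hf : D.NearColoring s v f)
    (hg : D.NearColoring s v g) {a : ℕ} (ha : 0 < a) (hak : a < k)
    (hlt : ∀ i < a, f (w i) ≠ g (w i)) (hge : ∀ i, a ≤ i → i < k → f (w i) = g (w i)) : False := by
  rcases h.ring_dichotomy hr with ⟨-, -, hp⟩ | hm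
  -- Period two links a position where the colourings differ to one where they agree: 0 to 2 if a =
  -- 1 (this needs k ≥ 3), and a - 2 to a otherwise.
  · by_cases h1 : a = 1
    · subst h1
      refine hlt 0 (by omega) ?_
      rw [hp f hf 0 (by omega), hp g hg 0 (by omega), Nat.mod_eq_of_lt (by omega)]
      exact hge _ (by omega) (by omega)
    · refine hlt (a - 2) (by omega) ?_
      rw [hp f hf _ (by omega), hp g hg _ (by omega), Nat.mod_eq_of_lt (by omega)]
      exact hge _ (by omega) (by omega)
  · refine hlt 0 ha ?_
    rw [hm f hf 0 (by omega) a hak, hm g hg 0 (by omega) a hak]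
    exact hge a le_rfl hak

/-- A ring whose ends have different colours has alternating colours. -/
theorem ring_alternating (h : D.IsObstruction s p) {v : V} {w : ℕ → V} {k : ℕ}
    (hr : D.IsRing v w k) {f : V → Fin p} (hf : D.NearColoring s v f)
    (hne : f (w 0) ≠ f (w (k - 1))) :
    Even k ∧ ∀ i < k, f (w i) ≠ f (w ((i + 1) % k)) := by
  have hk := hr.two_le
  rcases h.ring_dichotomy hr with ⟨-, -, hp⟩ | hm
  swap
  · exact absurd (hm f hf _ (by omega) _ (by omega)) hne
  have per : ∀ i < k, f (w i) = f (w (i % 2)) := by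
    intro i
    induction i using Nat.strong_induction_on with
    | _ i ih =>
      intro hi
      by_cases h2 : i < 2
      · rw [Nat.mod_eq_of_lt h2]
      · have h3 := hp f hf (i - 2) (by omega)
        rw [Nat.mod_eq_of_lt (by omega), show i - 2 + 2 = i by omega] at h3
        rw [← h3, ih (i - 2) (by omega) (by omega)]
        congr 2
        omega
  have heven : Even k := by
    rw [Nat.even_iff]
    by_contra hodd
    refine hne ?_
    rw [per (k - 1) (by omega), show (k - 1) % 2 = 0 by omega]
  have h01 : f (w 0) ≠ f (w 1) := by
    rw [Nat.even_iff] at heven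
    rwa [per (k - 1) (by omega), show (k - 1) % 2 = 1 by omega] at hne
  refine ⟨heven, fun i hi => ?_⟩
  rw [Nat.even_iff] at heven
  rw [per i hi, per _ (Nat.mod_lt _ (by omega))]
  have : (i + 1) % k % 2 = (i + 1) % 2 := by
    by_cases h1 : i + 1 < k
    · rw [Nat.mod_eq_of_lt h1]
    · rw [show i + 1 = k by omega, Nat.mod_self]
      omega
  rw [this]
  rcases Nat.mod_two_eq_zero_or_one i with h2 | h2
  · rw [h2, show (i + 1) % 2 = 1 by omega]
    exact h01
  · rw [h2, show (i + 1) % 2 = 0 by omega]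
    exact h01.symm

end IsObstruction

/-! ### Shortest walks and short rings -/

/-- A shortest walk avoiding `v` among those whose ends are related by `P`. -/
theorem exists_shortest_walk {G : SimpleGraph V} {v : V} (hG : (G.induce {v}ᶜ).Preconnected)
    {P : V → V → Prop} {a b : V} (ha : a ≠ v) (hb : b ≠ v) (hab : P a b) :
    ∃ (m : ℕ) (q : ℕ → V), P (q 0) (q m) ∧ (∀ i < m, G.Adj (q i) (q (i + 1))) ∧
      (∀ i ≤ m, q i ≠ v) ∧ (∀ i j, i ≤ j → j ≤ m → P (q i) (q j) → i = 0 ∧ j = m) ∧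
      (∀ i j, i ≤ j → j ≤ m → G.Adj (q i) (q j) → j ≤ i + 1) ∧
      ∀ i ≤ m, ∀ j ≤ m, q i = q j → i = j := by
  classical
  have hex : ∃ m, ∃ q : ℕ → V, P (q 0) (q m) ∧ (∀ i < m, G.Adj (q i) (q (i + 1))) ∧
      ∀ i ≤ m, q i ≠ v := by
    obtain ⟨W⟩ := hG ⟨a, ha⟩ ⟨b, hb⟩
    refine ⟨W.length, fun i => (W.getVert i).1, ?_, fun i hi => ?_, fun i _ => (W.getVert i).2⟩
    · simpa using hab
    · exact W.adj_getVert_succ hi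
  obtain ⟨q, hP, hadj, hv⟩ := Nat.find_spec hex
  have hmin := fun k hk => Nat.find_min hex (m := k) hk
  generalize Nat.find hex = m at hP hadj hv hmin
  have hP' : ∀ i j, i ≤ j → j ≤ m → P (q i) (q j) → i = 0 ∧ j = m := by
    intro i j hij hj hp
    by_contra hne
    refine hmin (j - i) (by omega) ⟨fun t => q (i + t), ?_, fun t ht => ?_, fun t ht => ?_⟩
    · simpa [Nat.add_sub_cancel' hij] using hp
    · exact hadj (i + t) (by omega)
    · exact hv _ (by omega)
  have hgeo : ∀ i j, i ≤ j → j ≤ m → G.Adj (q i) (q j) → j ≤ i + 1 := by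
    intro i j hij hj ha
    by_contra hlt
    refine hmin (m - (j - i - 1)) (by omega)
      ⟨fun t => if t ≤ i then q t else q (t + (j - i - 1)), ?_, fun t ht => ?_, fun t ht => ?_⟩
    · simp only [Nat.zero_le, if_true]
      rw [if_neg (by omega), show m - (j - i - 1) + (j - i - 1) = m by omega]
      exact hP
    · by_cases h1 : t + 1 ≤ i
      · simp only [h1, show t ≤ i by omega, if_true]
        exact hadj t (by omega)
      · by_cases h2 : t ≤ i
        · simp only [h1, h2, if_true, if_false]
          rw [show t + 1 + (j - i - 1) = j by omega, show t = i by omega]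
          exact ha
        · simp only [h1, h2, if_false]
          rw [show t + 1 + (j - i - 1) = t + (j - i - 1) + 1 by omega]
          exact hadj _ (by omega)
    · by_cases h2 : t ≤ i
      · simp only [h2, if_true]
        exact hv _ (by omega)
      · simp only [h2, if_false]
        exact hv _ (by omega)
  -- A repetition ending at m gives an earlier end of the walk; any other makes the edge leaving `q
  -- j` a shortcut from `q i`.
  have hlt : ∀ i j, i < j → j ≤ m → q i ≠ q j := by
    intro i j hij hj heq
    by_cases hjm : j = m
    · subst hjm
      have := (hP' 0 i (by omega) (by omega) (by rw [heq]; exact hP)).2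
      omega
    · have := hgeo i (j + 1) (by omega) (by omega) (by rw [heq]; exact hadj j (by omega))
      omega
  refine ⟨m, q, hP, hadj, hv, hP', hgeo, fun i hi j hj heq => ?_⟩
  rcases lt_trichotomy i j with h | h | h
  · exact absurd heq (hlt i j h hj)
  · exact h
  · exact absurd heq.symm (hlt j i h hi)

theorem isRing_triangle {D : Digraph V} {v a b : V} (ha : D.under.Adj v a) (hb : D.under.Adj v b)
    (hab : D.under.Adj a b) : D.IsRing v (fun i => if i = 0 then a else b) 2 where
  two_le := le_rfl
  adj i hi := by
    obtain rfl : i = 0 := by omega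
    simpa using hab
  inj i hi j hj h := by
    interval_cases i <;> interval_cases j <;> simp_all [hab.ne, hab.ne']
  ne i hi := by
    split_ifs
    exacts [ha.ne', hb.ne']
  adj_first := by simpa using ha
  adj_last := by simpa using hb
  not_adj i h0 hi := by omega

/-- Only chords at `z` are excluded; `x` and `y` may be adjacent. -/
theorem isRing_of_three {D : Digraph V} {z x t y : V} (hzx : D.under.Adj z x)
    (hxt : D.under.Adj x t) (hty : D.under.Adj t y) (hzy : D.under.Adj z y) (hxy : x ≠ y)
    (hzt : ¬ D.under.Adj z t) (htz : t ≠ z) :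
    D.IsRing z (fun i => if i = 0 then x else if i = 1 then t else y) 3 where
  two_le := by omega
  adj i hi := by
    obtain rfl | rfl : i = 0 ∨ i = 1 := by omega
    · simpa using hxt
    · simpa using hty
  inj i hi j hj h := by
    have h1 := hxt.ne
    have h2 := hty.ne
    obtain rfl | rfl | rfl : i = 0 ∨ i = 1 ∨ i = 2 := (by omega) <;>
      obtain rfl | rfl | rfl : j = 0 ∨ j = 1 ∨ j = 2 := (by omega) <;>
      simp [h1, h2, hxy, h1.symm, h2.symm, hxy.symm] at h ⊢
  ne i hi := by
    split_ifs
    exacts [hzx.ne', htz, hzy.ne']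
  adj_first := by simpa using hzx
  adj_last := by simpa using hzy
  not_adj i h0 hi := by
    obtain rfl : i = 1 := by omega
    simpa using hzt

/-! ### Two-coloured triangles and complete digraphs -/

namespace IsObstruction

variable [Finite V] {D : Digraph V} {s p : ℕ}

theorem swap_triangle (h : D.IsObstruction s p) {v a b : V} {f : V → Fin p}
    (hf : D.NearColoring s v f) (ha : D.under.Adj v a) (hb : D.under.Adj v b)
    (hab : D.under.Adj a b) :
    ∃ g : V → Fin p, D.NearColoring s v g ∧ g a = f b ∧ g b = f a ∧
      ∀ u, u ≠ v → u ≠ a → u ≠ b → g u = f u := by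
  obtain ⟨g, hg, hgi, hgu⟩ := h.rotate hf (isRing_triangle ha hb hab)
  refine ⟨g, hg, by simpa using hgi 0, by simpa using hgi 1, fun u hv hua hub => hgu u hv ?_⟩
  intro i _
  split_ifs <;> assumption

theorem adj_iff_of_triangle (h : D.IsObstruction s p) {v a b : V} {f : V → Fin p}
    (hf : D.NearColoring s v f) (ha : D.under.Adj v a) (hb : D.under.Adj v b)
    (hab : D.under.Adj a b) (hne : f a ≠ f b) :
    (D.Adj v a ↔ D.Adj v b) ∧ (D.Adj a v ↔ D.Adj b v) := by
  rcases h.ring_dichotomy (isRing_triangle ha hb hab) with ⟨h1, h2, -⟩ | hm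
  · exact ⟨by simpa using h1, by simpa using h2⟩
  · exact absurd (by simpa using hm f hf 0 (by omega) 1 (by omega)) hne

/-- If a triangle with an uncoloured vertex `v` has two colours, then in every clique containing
this triangle, any two vertices other than `v` have different colours for some near colouring. -/
theorem exists_color_ne_of_isClique (h : D.IsObstruction s p) {v : V} {f : V → Fin p}
    (hf : D.NearColoring s v f) {Q : Set V} (hQ : D.under.IsClique Q) (hv : v ∈ Q)
    {a b x y : V} (ha : a ∈ Q) (hb : b ∈ Q) (hav : a ≠ v) (hbv : b ≠ v)
    (hab : f a ≠ f b) (hxv : x ≠ v) (hy : y ∈ Q) (hyv : y ≠ v) (hxy : x ≠ y) :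
    ∃ g : V → Fin p, D.NearColoring s v g ∧ g x ≠ g y := by
  by_cases hfxy : f x = f y
  swap
  · exact ⟨f, hf, hfxy⟩
  obtain ⟨t, ht, htv, htx⟩ : ∃ t ∈ Q, t ≠ v ∧ f t ≠ f x := by
    by_cases h1 : f a = f x
    · exact ⟨b, hb, hbv, fun h2 => hab (h1.trans h2.symm)⟩
    · exact ⟨a, ha, hav, h1⟩
  have hty : t ≠ y := by
    rintro rfl
    exact htx hfxy.symm
  obtain ⟨g, hg, hgy, -, hgu⟩ :=
    -- Swapping the colours of `y` and `t` leaves `x` untouched.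
    h.swap_triangle hf (hQ hv hy hyv.symm) (hQ hv ht htv.symm) (hQ hy ht hty.symm)
  refine ⟨g, hg, ?_⟩
  rw [hgy, hgu x hxv hxy (by rintro rfl; exact htx rfl)]
  exact htx.symm

/-- The neighbours of a vertex `v` on a maximal clique containing a two-coloured triangle all belong
to this clique. -/
theorem mem_of_adj_of_maximal_isClique (h : D.IsObstruction s p) {v : V}
    (hconn : (D.under.induce {v}ᶜ).Preconnected) {f : V → Fin p}
    (hf : D.NearColoring s v f) {Q : Set V} (hQ : Maximal D.under.IsClique Q) (hv : v ∈ Q)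
    {a b : V} (ha : a ∈ Q) (hb : b ∈ Q) (hav : a ≠ v) (hbv : b ≠ v) (hab : f a ≠ f b) {z : V}
    (hz : D.under.Adj v z) : z ∈ Q := by
  by_contra hzQ
  obtain ⟨m, q, ⟨⟨hq0, hq0Q⟩, hqm, hqmv⟩, hadj, hqv, hmin, -, hinj⟩ :=
    exists_shortest_walk hconn (P := fun x y => (D.under.Adj v x ∧ x ∉ Q) ∧ y ∈ Q ∧ y ≠ v)
      hz.ne' hav ⟨⟨hz, hzQ⟩, ha, hav⟩
  have hm0 : m ≠ 0 := by
    rintro rfl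
    exact hq0Q hqm
  have hqQ : ∀ t < m, q t ∉ Q := fun t ht hmem => by
    have := (hmin 0 t (by omega) (by omega) ⟨⟨hq0, hq0Q⟩, hmem, hqv t (by omega)⟩).2
    omega
  by_cases hm1 : m = 1
  · subst hm1
    have hzu := hadj 0 (by omega)
    have hall : ∀ t ∈ Q, D.under.Adj (q 0) t := by
      intro t ht
      by_contra hnot
      have htv : t ≠ v := by
        rintro rfl
        exact hnot hq0.symm
      have hut : q 1 ≠ t := by
        rintro rfl
        exact hnot hzu
      obtain ⟨g, hg, hgne⟩ :=
        h.exists_color_ne_of_isClique hf hQ.prop hv ha hb hav hbv hab hqmv ht htv hut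
      obtain ⟨g', hg', -, hgu'⟩ := h.move hg hq0
      have hut' : g' (q 1) ≠ g' t := by rwa [hgu' _ hqmv, hgu' _ htv]
      have hring := isRing_of_three hzu (hQ.prop hqm ht hut) (hQ.prop ht hv htv) hq0.symm hqmv hnot
        (fun heq => hq0Q (heq ▸ ht))
      -- With k = 3 odd, cyclic period two already makes the ring monochromatic, yet `q 1` and `t`
      -- differ.
      rcases h.ring_dichotomy hring with ⟨-, -, hp⟩ | hm
      · have h0 := hp g' hg' 0 (by omega)
        have h1 := hp g' hg' 1 (by omega)
        simp at h0 h1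
        exact hut' (h0.trans (by rw [h1, h0]))
      · exact hut' (by simpa using hm g' hg' 0 (by omega) 1 (by omega))
    have hins : D.under.IsClique (insert (q 0) Q) :=
      SimpleGraph.isClique_insert.2 ⟨hQ.prop, fun t ht _ => hall t ht⟩
    exact hq0Q (hQ.le_of_ge hins (Set.subset_insert _ _) (Set.mem_insert _ _))
  · have hring : D.IsRing v (fun i => q (m - i)) (m + 1) :=
      { two_le := by omega
        adj := by
          intro i hi
          have := hadj (m - (i + 1)) (by omega)
          rw [show m - (i + 1) + 1 = m - i by omega] at this
          exact this.symm
        inj := by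
          intro i hi j hj heq
          have := hinj _ (by omega) _ (by omega) heq
          omega
        ne := fun i hi => hqv _ (by omega)
        adj_first := hQ.prop hv (by simpa using hqm) (by simpa using hqmv.symm)
        adj_last := by simpa using hq0
        not_adj := by
          intro i h0 hi hadjv
          have := (hmin (m - i) m (by omega) le_rfl
            ⟨⟨hadjv, hqQ _ (by omega)⟩, hqm, hqmv⟩).1
          omega }
    obtain ⟨t, ht, htv, htu⟩ : ∃ t ∈ Q, t ≠ v ∧ f t ≠ f (q m) := by
      by_cases h1 : f a = f (q m)
      · exact ⟨b, hb, hbv, fun h2 => hab (h1.trans h2.symm)⟩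
      · exact ⟨a, ha, hav, h1⟩
    have hne : q m ≠ t := by
      rintro rfl
      exact htu rfl
    -- On this ring, only `q m` changes colour under the swap with `t`.
    obtain ⟨g, hg, hgu, -, hg'⟩ := h.swap_triangle hf (hQ.prop hv hqm hqmv.symm)
      (hQ.prop hv ht htv.symm) (hQ.prop hqm ht hne)
    refine h.false_of_ring_of_differ hring (by omega) hf hg (a := 1) (by omega) (by omega) ?_ ?_
    · intro i hi
      obtain rfl : i = 0 := by omega
      simpa [hgu] using htu.symm
    · intro i h1 hi
      refine (hg' _ (hqv _ (by omega)) ?_ ?_).symm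
      · intro heq
        have := hinj _ (by omega) _ le_rfl heq
        omega
      · rintro rfl
        exact hqQ _ (by omega) ht

/-- An obstruction with a two-coloured triangle through a vertex that is not a cut vertex is
bidirected complete. -/
theorem isBidirectedComplete_of_triangle (h : D.IsObstruction s p) (hs : 1 ≤ s) {v : V}
    (hconn : (D.under.induce {v}ᶜ).Preconnected) {f : V → Fin p}
    (hf : D.NearColoring s v f) {a b : V} (ha : D.under.Adj v a) (hb : D.under.Adj v b)
    (hab : D.under.Adj a b) (hne : f a ≠ f b) : D.IsBidirectedComplete := by
  have hp : 0 < p := Fin.pos (f v)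
  have hps : 1 ≤ p * s := Nat.mul_pos hp hs
  have hclique : D.under.IsClique {v, a, b} := by
    simp [SimpleGraph.isClique_iff, Set.Pairwise, ha, hb, hab, ha.symm, hb.symm, hab.symm]
  obtain ⟨Q, hsub, hQ⟩ := (Set.toFinite {Q : Set V | D.under.IsClique Q}).exists_le_maximal hclique
  replace hQ : Maximal D.under.IsClique Q := hQ
  have hvQ : v ∈ Q := hsub (by simp)
  have haQ : a ∈ Q := hsub (by simp)
  have hbQ : b ∈ Q := hsub (by simp)
  have hadjQ : ∀ x, D.under.Adj v x → x ∈ Q := fun x hx =>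
    h.mem_of_adj_of_maximal_isClique hconn hf hQ hvQ haQ hbQ ha.ne' hb.ne' hne hx
  have hcol : ∀ x, ∀ y ∈ Q, x ≠ v → y ≠ v → x ≠ y →
      ∃ g : V → Fin p, D.NearColoring s v g ∧ g x ≠ g y := fun x y hy hxv hyv hxy =>
    h.exists_color_ne_of_isClique hf hQ.prop hvQ haQ hbQ ha.ne' hb.ne' hne hxv hy hyv hxy
  have hiff : ∀ x ∈ Q, ∀ y ∈ Q, x ≠ v → y ≠ v →
      (D.Adj v x ↔ D.Adj v y) ∧ (D.Adj x v ↔ D.Adj y v) := by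
    intro x hx y hy hxv hyv
    by_cases hxy : x = y
    · simp [hxy]
    obtain ⟨g, hg, hgne⟩ := hcol x y hy hxv hyv hxy
    exact h.adj_iff_of_triangle hg (hQ.prop hvQ hx hxv.symm) (hQ.prop hvQ hy hyv.symm)
      (hQ.prop hx hy hxy) hgne
  have hv_out : ∀ x ∈ Q, x ≠ v → D.Adj v x := by
    obtain ⟨y, hy⟩ := Set.nonempty_of_ncard_ne_zero (s := {w | D.Adj v w})
      (by have := (h.ncard_adj hp v).1; omega)
    have hy' := h.loopless.under_adj.2 (Or.inl hy : D.Adj v y ∨ D.Adj y v)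
    exact fun x hx hxv => (hiff x hx y (hadjQ y hy') hxv hy'.ne').1.2 hy
  have hv_in : ∀ x ∈ Q, x ≠ v → D.Adj x v := by
    obtain ⟨y, hy⟩ := Set.nonempty_of_ncard_ne_zero (s := {w | D.Adj w v})
      (by have := (h.ncard_adj hp v).2; omega)
    have hy' := h.loopless.under_adj.2 (Or.inr hy : D.Adj v y ∨ D.Adj y v)
    exact fun x hx hxv => (hiff x hx y (hadjQ y hy') hxv hy'.ne').2.2 hy
  have hcomplete : ∀ x ∈ Q, ∀ y ∈ Q, x ≠ y → D.Adj x y := by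
    intro x hx y hy hxy
    by_cases hxv : x = v
    · subst hxv
      exact hv_out y hy hxy.symm
    by_cases hyv : y = v
    · subst hyv
      exact hv_in x hx hxy
    obtain ⟨g, hg, hgne⟩ := hcol x y hy hxv hyv hxy
    -- After the move, `v` has the old colour of `x`, so the triangle at `x` through `v` and `y` is
    -- two-coloured and the arcs at `x` to `y` copy those to `v`.
    obtain ⟨g', hg', hgv, hgu⟩ := h.move hg (hQ.prop hvQ hx (Ne.symm hxv))
    refine (h.adj_iff_of_triangle hg' (hQ.prop hx hvQ hxv) (hQ.prop hx hy hxy)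
      (hQ.prop hvQ hy (Ne.symm hyv)) ?_).1.1 (hv_in x hx hxv)
    rwa [hgv, hgu y hyv]
  have hcard : (Q \ {v}).ncard = p * s := by
    rw [← (h.ncard_adj hp v).1]
    congr 1
    ext x
    exact ⟨fun hx => hv_out x hx.1 hx.2, fun hx =>
      have hx' := h.loopless.under_adj.2 (Or.inl hx : D.Adj v x ∨ D.Adj x v)
      ⟨hadjQ x hx', hx'.ne'⟩⟩
  have hcard' : ∀ x ∈ Q, (Q \ {x}).ncard = p * s := by
    intro x hx
    rw [← hcard, Set.ncard_sdiff_singleton_of_mem hx, Set.ncard_sdiff_singleton_of_mem hvQ]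
  -- Each vertex of `Q` already spends its full degree ps inside `Q`, so no arc leaves or enters
  -- `Q`.
  have huniv : ∀ y, y ∈ Q := by
    by_contra! hex
    obtain ⟨y, hy⟩ := hex
    obtain ⟨x, hx, z, hz, hxz⟩ := SimpleGraph.Connected.exists_adj_mem_notMem h.connected hvQ hy
    rcases h.loopless.under_adj.1 hxz with hxz | hxz
    · have heq : Q \ {x} = {w | D.Adj x w} := Set.eq_of_subset_of_ncard_le
        (fun w hw => hcomplete x hx w hw.1 (Ne.symm hw.2))
        (by rw [hcard' x hx]; exact h.out_le x)
      exact hz (heq.symm ▸ hxz : z ∈ Q \ {x}).1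
    · have heq : Q \ {x} = {w | D.Adj w x} := Set.eq_of_subset_of_ncard_le
        (fun w hw => hcomplete w hw.1 x hx hw.2)
        (by rw [hcard' x hx]; exact h.in_le x)
      exact hz (heq.symm ▸ hxz : z ∈ Q \ {x}).1
  unfold IsBidirectedComplete bidirected
  ext x y
  simp only [SimpleGraph.top_adj]
  refine ⟨?_, fun hxy => hcomplete x (huniv x) y (huniv y) hxy⟩
  rintro hxy rfl
  exact h.loopless _ hxy

end IsObstruction

/-! ### Induced rings and odd cycles -/

/-- Replacing a final segment of a ring by a path that leaves the ring. -/
theorem IsRing.ear {D : Digraph V} {v : V} {w : ℕ → V} {k : ℕ} (hr : D.IsRing v w k) {m a : ℕ}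
    {q : ℕ → V} (hm : 0 < m) (ha : a + 1 < k) (hqm : q m = w a)
    (hadj : ∀ i < m, D.under.Adj (q i) (q (i + 1))) (hqv : ∀ i ≤ m, q i ≠ v)
    (hinj : ∀ i ≤ m, ∀ j ≤ m, q i = q j → i = j) (hq0 : D.under.Adj v (q 0))
    (hqi : ∀ i, 0 < i → i < m → ¬ D.under.Adj v (q i))
    (hqw : ∀ t < m, ∀ i < k, q t ≠ w i) :
    D.IsRing v (fun i => if i ≤ a then w i else q (m + a - i)) (a + m + 1) where
  two_le := by omega
  adj i hi := by
    by_cases h1 : i + 1 ≤ a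
    · simp only [h1, show i ≤ a by omega, if_true]
      exact hr.adj i (by omega)
    · by_cases h2 : i ≤ a
      · obtain rfl : i = a := by omega
        simp only [le_refl, h1, if_true, if_false]
        rw [← hqm]
        have := hadj (m - 1) (by omega)
        rw [show m - 1 + 1 = m by omega] at this
        rw [show m + i - (i + 1) = m - 1 by omega]
        exact this.symm
      · simp only [h1, h2, if_false]
        have := hadj (m + a - (i + 1)) (by omega)
        rw [show m + a - (i + 1) + 1 = m + a - i by omega] at this
        exact this.symm
  inj i hi j hj h := by
    by_cases h1 : i ≤ a <;> by_cases h2 : j ≤ a <;> simp only [h1, h2, if_true, if_false] at h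
    · exact hr.inj _ (by omega) _ (by omega) h
    · exact absurd h.symm (hqw _ (by omega) _ (by omega))
    · exact absurd h (hqw _ (by omega) _ (by omega))
    · have := hinj _ (by omega) _ (by omega) h
      omega
  ne i hi := by
    split_ifs
    exacts [hr.ne _ (by omega), hqv _ (by omega)]
  adj_first := by simpa using hr.adj_first
  adj_last := by
    rw [if_neg (by omega), show m + a - (a + m + 1 - 1) = 0 by omega]
    exact hq0
  not_adj i h0 hi := by
    split_ifs
    exacts [hr.not_adj _ h0 (by omega), hqi _ (by omega) (by omega)]

/-- An induced ring, started at another of its vertices. -/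
theorem IsRing.shift {D : Digraph V} {v : V} {w : ℕ → V} {k : ℕ} (hr : D.IsRing v w k)
    (hgeo : ∀ i j, i ≤ j → j < k → D.under.Adj (w i) (w j) → j ≤ i + 1) {i : ℕ} (hi : i + 1 < k) :
    D.IsRing (w i) (fun j => if j + i + 1 < k then w (i + 1 + j) else
      if j + i + 1 = k then v else w (j + i - k)) k where
  two_le := hr.two_le
  -- Read from `w i`, the order is `w (i + 1)`, …, `w (k - 1)`, `v`, `w 0`, …, `w (i - 1)`, with `v`
  -- at index k - 1 - i.
  adj j hj := by
    rcases lt_trichotomy (j + i + 2) k with h | h | h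
    · rw [if_pos (by omega), if_pos (by omega)]
      exact hr.adj _ (by omega)
    · rw [if_pos (by omega), if_neg (by omega), if_pos (by omega),
        show i + 1 + j = k - 1 by omega]
      exact hr.adj_last.symm
    · by_cases h1 : j + i + 1 = k
      · rw [if_neg (by omega), if_pos (by omega), if_neg (by omega), if_neg (by omega),
          show j + 1 + i - k = 0 by omega]
        exact hr.adj_first
      · rw [if_neg (by omega), if_neg (by omega), if_neg (by omega), if_neg (by omega),
          show j + 1 + i - k = j + i - k + 1 by omega]
        exact hr.adj _ (by omega)
  inj j hj l hl h := by
    split_ifs at h with h1 h2 h3 h4 h5 h6 h7 h8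
    · have := hr.inj _ (by omega) _ (by omega) h
      omega
    · exact absurd h (hr.ne _ (by omega))
    · have := hr.inj _ (by omega) _ (by omega) h
      omega
    · exact absurd h.symm (hr.ne _ (by omega))
    · omega
    · exact absurd h.symm (hr.ne _ (by omega))
    · have := hr.inj _ (by omega) _ (by omega) h
      omega
    · exact absurd h (hr.ne _ (by omega))
    · have := hr.inj _ (by omega) _ (by omega) h
      omega
  ne j hj := by
    split_ifs
    · intro h
      have := hr.inj _ (by omega) _ (by omega) h
      omega
    · exact (hr.ne _ (by omega)).symm
    · intro h
      have := hr.inj _ (by omega) _ (by omega) h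
      omega
  adj_first := by
    rw [if_pos (by omega)]
    exact hr.adj _ hi
  adj_last := by
    rw [if_neg (by omega)]
    split_ifs with h
    · obtain rfl : i = 0 := by omega
      exact hr.adj_first.symm
    · have := hr.adj (i - 1) (by omega)
      rw [show i - 1 + 1 = i by omega] at this
      rw [show k - 1 + i - k = i - 1 by omega]
      exact this.symm
  not_adj j h0 hj := by
    split_ifs
    · intro h
      have := hgeo _ _ (by omega) (by omega) h
      omega
    · intro h
      exact hr.not_adj i (by omega) hi h.symm
    · intro h
      have := hgeo _ _ (by omega) (by omega) h.symm
      omega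

namespace IsObstruction

variable [Finite V] {D : Digraph V} {s p : ℕ}

/-- If `v` lies on no two-coloured triangle, its only neighbours are its neighbours on a ring. -/
theorem eq_or_eq_of_adj (h : D.IsObstruction s p) {v : V}
    (hconn : (D.under.induce {v}ᶜ).Preconnected)
    (hT : ∀ g : V → Fin p, D.NearColoring s v g → ∀ x y, D.under.Adj v x → D.under.Adj v y →
      D.under.Adj x y → g x = g y) {w : ℕ → V} {k : ℕ} (hr : D.IsRing v w k)
    {f : V → Fin p} (hf : D.NearColoring s v f) (hne : f (w 0) ≠ f (w (k - 1))) {z : V}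
    (hz : D.under.Adj v z) : z = w 0 ∨ z = w (k - 1) := by
  have hk := hr.two_le
  by_contra! hz'
  obtain ⟨m, q, ⟨⟨hq0, hq00, hq01⟩, a, hak, hqm⟩, hadj, hqv, hmin, -, hinj⟩ :=
    exists_shortest_walk hconn
      (P := fun x y => (D.under.Adj v x ∧ x ≠ w 0 ∧ x ≠ w (k - 1)) ∧ ∃ i < k, y = w i)
      hz.ne' (hr.ne 0 (by omega)) ⟨⟨hz, hz'⟩, 0, by omega, rfl⟩
  have hm : 0 < m := by
    rw [Nat.pos_iff_ne_zero]
    rintro rfl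
    rw [hqm] at hq0 hq00 hq01
    refine hr.not_adj a (Nat.pos_of_ne_zero ?_) ?_ hq0
    · rintro rfl
      exact hq00 rfl
    · by_contra hh
      exact hq01 (by rw [show a = k - 1 by omega])
  have hqw : ∀ t < m, ∀ i < k, q t ≠ w i := by
    intro t ht i hi heq
    have := (hmin 0 t (by omega) (by omega) ⟨⟨hq0, hq00, hq01⟩, i, hi, heq⟩).2
    omega
  have hqi : ∀ i, 0 < i → i < m → ¬ D.under.Adj v (q i) := by
    intro i h0 hi hadjv
    have := (hmin i m (by omega) le_rfl
      ⟨⟨hadjv, hqw i hi 0 (by omega), hqw i hi _ (by omega)⟩, a, hak, hqm⟩).1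
    omega
  have main : ∀ (w : ℕ → V) (a : ℕ), D.IsRing v w k → f (w 0) ≠ f (w (k - 1)) → a + 1 < k →
      q m = w a → (∀ t < m, ∀ i < k, q t ≠ w i) → False := by
    intro w a hr hne ha hqm hqw
    have hear := hr.ear hm ha hqm hadj hqv hinj hq0 hqi hqw
    -- Rotating the alternating ring changes every colour on it and none on the path `q` before its
    -- end. On the rerouted ring, `f` and `g` thus differ exactly on the initial segment up to `w
    -- a`.
    obtain ⟨g, hg, hgi, hgu⟩ := h.rotate hf hr
    have hdiff : ∀ i ≤ a, f (w i) ≠ g (w i) := by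
      intro i hi
      rw [hgi i (by omega)]
      exact (h.ring_alternating hr hf hne).2 i (by omega)
    have hsame : ∀ t < m, f (q t) = g (q t) := fun t ht =>
      (hgu _ (hqv t (by omega)) (hqw t ht)).symm
    by_cases h3 : a + m + 1 = 2
    · obtain rfl : a = 0 := by omega
      obtain rfl : m = 1 := by omega
      have hzw := hadj 0 (by omega)
      rw [Nat.zero_add, hqm] at hzw
      refine hdiff 0 le_rfl ?_
      rw [hT f hf _ _ hr.adj_first hq0 hzw.symm, hT g hg _ _ hr.adj_first hq0 hzw.symm]
      exact hsame 0 (by omega)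
    · refine h.false_of_ring_of_differ hear (by omega) hf hg (a := a + 1) (by omega) (by omega)
        ?_ ?_
      · intro i hi
        rw [if_pos (by omega)]
        exact hdiff i (by omega)
      · intro i h1 hi
        rw [if_neg (by omega)]
        exact hsame _ (by omega)
  by_cases ha : a + 1 < k
  · exact main w a hr hne ha hqm hqw
  -- If the path ends at `w (k - 1)`, reversing the ring makes this its first vertex.
  · refine main (fun i => w (k - 1 - i)) 0 hr.reverse ?_ (by omega) ?_ ?_
    · simpa using hne.symm
    · rw [hqm]
      congr 1
      omega
    · exact fun t ht i hi => hqw t ht _ (by omega)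

/-- On an induced ring with ends of different colours, the two edges of the ring at each vertex are
of the same kind. -/
theorem adj_iff_of_ring (h : D.IsObstruction s p) {v : V} {w : ℕ → V} {k : ℕ}
    (hr : D.IsRing v w k)
    (hgeo : ∀ i j, i ≤ j → j < k → D.under.Adj (w i) (w j) → j ≤ i + 1)
    {f : V → Fin p} (hf : D.NearColoring s v f) (hne : f (w 0) ≠ f (w (k - 1))) {i : ℕ}
    (hi : i + 1 < k) :
    (D.Adj (w i) (w (i + 1)) ↔ D.Adj (w i) (if i = 0 then v else w (i - 1))) ∧
      (D.Adj (w (i + 1)) (w i) ↔ D.Adj (if i = 0 then v else w (i - 1)) (w i)) := by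
  obtain ⟨g, hg, hgv, hgi, hgu⟩ :=
    h.slide hf hr.adj_first hr.adj hr.inj hr.ne i (by omega)
  have hlast : (if k - 1 + i + 1 < k then w (i + 1 + (k - 1)) else
      if k - 1 + i + 1 = k then v else w (k - 1 + i - k)) = if i = 0 then v else w (i - 1) := by
    rw [if_neg (by omega)]
    by_cases h0 : i = 0
    · rw [if_pos (by omega), if_pos h0]
    · rw [if_neg (by omega), if_neg h0, show k - 1 + i - k = i - 1 by omega]
  have h01 := (h.ring_alternating hr hf hne).2 0 (by omega)
  rw [Nat.zero_add, Nat.mod_eq_of_lt (by omega)] at h01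
  rcases h.ring_dichotomy (hr.shift hgeo hi) with ⟨h1, h2, -⟩ | hm
  · rw [hlast, if_pos (by omega)] at h1 h2
    exact ⟨h1, h2⟩
  -- After the slide, `v` carries the colour of `w 0`, while `w 1` (for i = 0) or `w 0` (for i > 0)
  -- carries the colour of `w 1`, so the shifted ring is not monochromatic.
  · exfalso
    by_cases h0 : i = 0
    · subst h0
      have := hm g hg 0 (by omega) (k - 1) (by omega)
      rw [hlast, if_pos (by omega), if_pos rfl, hgv] at this
      rw [hgu _ (hr.ne _ (by omega))] at this
      · exact h01 this.symm
      · intro j hj heq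
        have := hr.inj _ (by omega) _ (by omega) heq
        omega
    · have := hm g hg (k - 1 - i) (by omega) (k - i) (by omega)
      rw [if_neg (by omega), if_pos (by omega), if_neg (by omega), if_neg (by omega), hgv,
        show k - i + i - k = 0 by omega, hgi 0 (by omega)] at this
      exact h01 this

/-- An obstruction with a vertex that is neither a cut vertex nor on a two-coloured triangle is a
bidirected odd cycle. -/
theorem isBidirectedOddCycle_of_no_triangle (h : D.IsObstruction s p) (hs : 1 ≤ s) (hp : 2 ≤ p)
    {v : V} (hconn : (D.under.induce {v}ᶜ).Preconnected)
    (hT : ∀ g : V → Fin p, D.NearColoring s v g → ∀ x y, D.under.Adj v x → D.under.Adj v y →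
      D.under.Adj x y → g x = g y) : D.IsBidirectedOddCycle := by
  obtain ⟨f, hf⟩ := h.exists_nearColoring (by omega) v
  have hcolor : ∀ i, ∃ x, D.under.Adj v x ∧ f x = i := by
    intro i
    obtain ⟨x, hx, hxi⟩ := Set.nonempty_of_ncard_ne_zero (s := {w | D.Adj v w ∧ f w = i})
      (by have := (h.ncard_color hf i).1; omega)
    exact ⟨x, h.loopless.under_adj.2 (Or.inl hx), hxi⟩
  obtain ⟨x, hx, hfx⟩ := hcolor ⟨0, by omega⟩
  obtain ⟨y, hy, hfy⟩ := hcolor ⟨1, by omega⟩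
  obtain ⟨m, w, ⟨hw0, hwm, hne⟩, hadj, hwv, hmin, hgeo, hinj⟩ :=
    exists_shortest_walk hconn (P := fun x y => D.under.Adj v x ∧ D.under.Adj v y ∧ f x ≠ f y)
      hx.ne' hy.ne' ⟨hx, hy, by rw [hfx, hfy]; simp⟩
  have hm0 : m ≠ 0 := by
    rintro rfl
    exact hne rfl
  have hm1 : m ≠ 1 := by
    rintro rfl
    exact hne (hT f hf _ _ hw0 hwm (hadj 0 (by omega)))
  have hr : D.IsRing v w (m + 1) :=
    { two_le := by omega
      adj := fun i hi => hadj i (by omega)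
      inj := fun i hi j hj => hinj i (by omega) j (by omega)
      ne := fun i hi => hwv i (by omega)
      adj_first := hw0
      adj_last := hwm
      not_adj := by
        intro i h0 hi hvi
        -- An inner neighbour of `v` differs in colour from one of the ends and would give a shorter
        -- walk.
        by_cases hc : f (w i) = f (w 0)
        · have := (hmin i m (by omega) le_rfl ⟨hvi, hwm, hc ▸ hne⟩).1
          omega
        · have := (hmin 0 i (by omega) (by omega) ⟨hw0, hvi, Ne.symm hc⟩).2
          omega }
  have heven := (h.ring_alternating hr hf hne).1
  have hnbr : ∀ z, D.under.Adj v z → z = w 0 ∨ z = w m := fun z hz =>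
    h.eq_or_eq_of_adj hconn hT hr hf hne hz
  have hpair : ({w 0, w m} : Set V).ncard = 2 :=
    Set.ncard_pair fun heq => hm0 (hinj 0 (by omega) m le_rfl heq).symm
  have hps : 2 ≤ p * s := le_trans hp (Nat.le_mul_of_pos_right p hs)
  have hout : {u | D.Adj v u} = {w 0, w m} := Set.eq_of_subset_of_ncard_le
    (fun u hu => hnbr u (h.loopless.under_adj.2 (Or.inl hu)))
    (by rw [hpair, (h.ncard_adj (by omega) v).1]; exact hps)
  have hin : {u | D.Adj u v} = {w 0, w m} := Set.eq_of_subset_of_ncard_le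
    (fun u hu => hnbr u (h.loopless.under_adj.2 (Or.inr hu)))
    (by rw [hpair, (h.ncard_adj (by omega) v).2]; exact hps)
  have hps2 : p * s = 2 := by rw [← hpair, ← hout, (h.ncard_adj (by omega) v).1]
  have hv0 : D.Adj v (w 0) := (hout.symm ▸ Or.inl rfl : w 0 ∈ {u | D.Adj v u})
  have hvm : D.Adj v (w m) := (hout.symm ▸ Or.inr rfl : w m ∈ {u | D.Adj v u})
  have h0v : D.Adj (w 0) v := (hin.symm ▸ Or.inl rfl : w 0 ∈ {u | D.Adj u v})
  have hmv : D.Adj (w m) v := (hin.symm ▸ Or.inr rfl : w m ∈ {u | D.Adj u v})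
  -- Both ring edges at `v` are bidirected, and this passes from edge to edge along the ring.
  have hdig : ∀ i < m, D.Adj (w i) (w (i + 1)) ∧ D.Adj (w (i + 1)) (w i) := by
    intro i
    induction i with
    | zero =>
      intro hi
      have := h.adj_iff_of_ring hr (fun i j hij hj => hgeo i j hij (by omega)) hf hne
        (i := 0) (by omega)
      simp only [if_true] at this
      exact ⟨this.1.2 h0v, this.2.2 hv0⟩
    | succ i ih =>
      intro hi
      have := h.adj_iff_of_ring hr (fun i j hij hj => hgeo i j hij (by omega)) hf hne
        (i := i + 1) (by omega)
      simp only [Nat.add_eq_zero_iff, one_ne_zero, and_false, if_false, Nat.add_sub_cancel] at this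
      exact ⟨this.1.2 (ih (by omega)).2, this.2.2 (ih (by omega)).1⟩
  -- the cycle, indexed from `0` to `m + 1`
  let c : ℕ → V := fun i => if i = 0 then v else w (i - 1)
  have hc_inj : ∀ i ≤ m + 1, ∀ j ≤ m + 1, c i = c j → i = j := by
    intro i hi j hj heq
    simp only [c] at heq
    split_ifs at heq with h1 h2 h2
    · omega
    · exact absurd heq.symm (hwv _ (by omega))
    · exact absurd heq (hwv _ (by omega))
    · have := hinj _ (by omega) _ (by omega) heq
      omega
  have hc_adj : ∀ i ≤ m, D.Adj (c i) (c (i + 1)) ∧ D.Adj (c (i + 1)) (c i) := by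
    intro i hi
    by_cases h0 : i = 0
    · subst h0
      exact ⟨hv0, h0v⟩
    · have := hdig (i - 1) (by omega)
      rw [show i - 1 + 1 = i by omega] at this
      simpa [c, h0] using this
  have hc_last : D.Adj (c 0) (c (m + 1)) ∧ D.Adj (c (m + 1)) (c 0) := ⟨hvm, hmv⟩
  have hc_nbr : ∀ i ≤ m + 1, ∃ a ≤ m + 1, ∃ b ≤ m + 1, a ≠ b ∧
      (a = i + 1 ∨ i = m + 1 ∧ a = 0) ∧ (i = b + 1 ∨ b = m + 1 ∧ i = 0) ∧
      D.Adj (c i) (c a) ∧ D.Adj (c a) (c i) ∧ D.Adj (c i) (c b) ∧ D.Adj (c b) (c i) := by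
    intro i hi
    by_cases h0 : i = 0
    · subst h0
      have := hc_adj 0 (by omega)
      exact ⟨1, by omega, m + 1, by omega, by omega, by omega, by omega, this.1, this.2,
        hc_last.1, hc_last.2⟩
    · have h1 := hc_adj (i - 1) (by omega)
      rw [show i - 1 + 1 = i by omega] at h1
      by_cases h2 : i = m + 1
      · subst h2
        exact ⟨0, by omega, m, by omega, by omega, by omega, by omega, hc_last.2, hc_last.1,
          h1.2, h1.1⟩
      · have h3 := hc_adj i (by omega)
        exact ⟨i + 1, by omega, i - 1, by omega, by omega, by omega, by omega, h3.1, h3.2,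
          h1.2, h1.1⟩
  have hc_sym : ∀ i ≤ m + 1, ∀ z, D.under.Adj (c i) z →
      ∃ j ≤ m + 1, z = c j ∧ (j = i + 1 ∨ i = j + 1 ∨ i = 0 ∧ j = m + 1 ∨ i = m + 1 ∧ j = 0) ∧
        D.Adj (c i) z := by
    intro i hi z hz
    obtain ⟨a, ha, b, hb, hab, hai, hbi, h1, h2, h3, h4⟩ := hc_nbr i hi
    have hcard : ({c a, c b} : Set V).ncard = 2 :=
      Set.ncard_pair fun heq => hab (hc_inj a ha b hb heq)
    -- Since ps = 2, the two cycle neighbours exhaust both degrees.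
    have ho : ({c a, c b} : Set V) = {u | D.Adj (c i) u} := Set.eq_of_subset_of_ncard_le
      (by rintro u (rfl | rfl) <;> assumption)
      (by rw [hcard, (h.ncard_adj (by omega) (c i)).1, hps2])
    have hi' : ({c a, c b} : Set V) = {u | D.Adj u (c i)} := Set.eq_of_subset_of_ncard_le
      (by rintro u (rfl | rfl) <;> assumption)
      (by rw [hcard, (h.ncard_adj (by omega) (c i)).2, hps2])
    have hz' : z ∈ ({c a, c b} : Set V) := by
      rcases h.loopless.under_adj.1 hz with hz | hz
      · rw [ho]; exact hz
      · rw [hi']; exact hz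
    rcases hz' with rfl | rfl
    · exact ⟨a, ha, rfl, by omega, h1⟩
    · exact ⟨b, hb, rfl, by omega, h3⟩
  have hsurj : ∀ z, ∃ i ≤ m + 1, c i = z := by
    by_contra! hex
    obtain ⟨z, hz⟩ := hex
    obtain ⟨x, ⟨i, hi, rfl⟩, y, hy, hxy⟩ := SimpleGraph.Connected.exists_adj_mem_notMem h.connected
      (S := {z | ∃ i ≤ m + 1, c i = z}) ⟨0, by omega, rfl⟩ (b := z)
      (by rintro ⟨i, hi, heq⟩; exact hz i hi heq)
    obtain ⟨j, hj, rfl, -⟩ := hc_sym i hi y hxy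
    exact hy ⟨j, hj, rfl⟩
  have hbij : Function.Bijective fun i : Fin (m + 2) => c i := by
    constructor
    · intro i j heq
      exact Fin.ext (hc_inj i (by omega) j (by omega) heq)
    · intro z
      obtain ⟨i, hi, rfl⟩ := hsurj z
      exact ⟨⟨i, by omega⟩, rfl⟩
  have hiff : ∀ i j : Fin (m + 2), i < j →
      (D.under.Adj (c i) (c j) ↔ (SimpleGraph.cycleGraph (m + 2)).Adj i j) := by
    intro i j hij
    have h1 : (j - i).val = j - i := Fin.coe_sub_iff_le.2 hij.le
    -- For i < j this wrapped difference is 1 only for the closing edge, i = 0 and j = m + 1.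
    have h2 : (i - j).val = m + 2 + i - j := Fin.coe_sub_iff_lt.2 hij
    rw [SimpleGraph.cycleGraph_adj', h1, h2]
    have hij' : i.val < j.val := hij
    constructor
    · intro ha
      obtain ⟨l, hl, hjl, hc, -⟩ := hc_sym i (by omega) _ ha
      have := hc_inj j (by omega) l hl hjl
      omega
    · rintro (hc | hc)
      · rw [show i.val = 0 by omega, show j.val = m + 1 by omega]
        exact h.loopless.under_adj.2 (Or.inl hc_last.1)
      · rw [show j.val = i.val + 1 by omega]
        exact h.loopless.under_adj.2 (Or.inl (hc_adj i (by omega)).1)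
  have hiso : ∀ i j : Fin (m + 2),
      D.under.Adj (c i) (c j) ↔ (SimpleGraph.cycleGraph (m + 2)).Adj i j := by
    intro i j
    rcases lt_trichotomy i j with hij | rfl | hij
    · exact hiff i j hij
    · simp
    · rw [SimpleGraph.adj_comm, hiff j i hij, SimpleGraph.adj_comm]
  refine ⟨D.under, m + 2, ?_, by omega, ?_, ⟨?_⟩⟩
  · unfold bidirected
    ext a b
    refine ⟨fun hab => h.loopless.under_adj.2 (Or.inl hab), fun hab => ?_⟩
    obtain ⟨i, hi, rfl⟩ := hsurj a
    obtain ⟨-, -, -, -, hh⟩ := hc_sym i hi b hab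
    exact hh
  · rw [Nat.odd_iff]
    rw [Nat.even_iff] at heven
    omega
  · exact SimpleGraph.Iso.symm ⟨Equiv.ofBijective _ hbij, fun {i j} => hiso i j⟩

/-! ### Conclusion -/

theorem isBidirectedComplete_or_isBidirectedOddCycle (h : D.IsObstruction s p) (hs : 1 ≤ s)
    (hp : 2 ≤ p) : D.IsBidirectedComplete ∨ D.IsBidirectedOddCycle := by
  obtain ⟨v, hv⟩ := SimpleGraph.Connected.exists_preconnected_induce_compl_singleton_of_finite
    (G := D.under) h.connected
  by_cases hT : ∀ g : V → Fin p, D.NearColoring s v g → ∀ x y, D.under.Adj v x →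
      D.under.Adj v y → D.under.Adj x y → g x = g y
  · exact Or.inr (h.isBidirectedOddCycle_of_no_triangle hs hp hv hT)
  · push Not at hT
    obtain ⟨g, hg, x, y, hx, hy, hxy, hne⟩ := hT
    exact Or.inl (h.isBidirectedComplete_of_triangle hs hv hg hx hy hxy hne)

end IsObstruction

theorem max_degree_le_maxSemidegree [Fintype V] (D : Digraph V) (v : V) :
    max (D.outDegree v) (D.inDegree v) ≤ D.maxSemidegree :=
  Finset.le_sup (f := fun v => max (D.outDegree v) (D.inDegree v)) (Finset.mem_univ v)

theorem isBidirectedComplete_of_maxSemidegree_eq_zero [Fintype V] {D : Digraph V}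
    (hloop : D.Loopless) (hconn : D.IsConnected) (h0 : D.maxSemidegree = 0) :
    D.IsBidirectedComplete := by
  have hno : ∀ a b, ¬ D.Adj a b := by
    intro a b hab
    have h1 := D.max_degree_le_maxSemidegree a
    rw [h0] at h1
    have h2 : {w | D.Adj a w}.ncard = 0 := by
      have := le_max_left (D.outDegree a) (D.inDegree a)
      unfold outDegree at this h1
      omega
    rw [Set.ncard_eq_zero] at h2
    exact (h2 ▸ hab : b ∈ (∅ : Set V))
  unfold IsBidirectedComplete bidirected
  ext a b
  simp only [hno, SimpleGraph.top_adj, false_iff, not_not]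
  by_contra hab
  obtain ⟨x, -, y, -, hxy⟩ := SimpleGraph.Connected.exists_adj_mem_notMem hconn
    (S := {a}) rfl (b := b) (by simpa using Ne.symm hab)
  rcases hloop.under_adj.1 hxy with h | h <;> exact hno _ _ h

end Digraph

theorem mainTheorem4 {V : Type*} [Fintype V] (D : Digraph V) (hloop : D.Loopless)
    (hconn : D.IsConnected) (s : ℕ) (hs : 1 ≤ s)
    (hcycle : ¬ D.IsBidirectedOddCycle)
    (hcomplete : ¬ D.IsBidirectedComplete)
    (hregular : ¬ (D.IsEulerian ∧ ∀ v, D.outDegree v = s ∧ D.inDegree v = s)) :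
    D.HasDegeneratePartition s ⌈(D.maxSemidegree : ℚ) / (s : ℚ)⌉₊ ∧
      D.degenerateDichromaticNumber s ≤ (⌈(D.maxSemidegree : ℚ) / (s : ℚ)⌉₊ : ℕ∞) := by
  generalize hp : ⌈(D.maxSemidegree : ℚ) / (s : ℚ)⌉₊ = p
  suffices hpart : D.HasDegeneratePartition s p from ⟨hpart, iInf₂_le p hpart⟩
  have hs0 : (0 : ℚ) < s := by exact_mod_cast hs
  have hle : D.maxSemidegree ≤ p * s := by
    have := Nat.le_ceil ((D.maxSemidegree : ℚ) / (s : ℚ))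
    rw [hp, div_le_iff₀ hs0] at this
    exact_mod_cast this
  by_contra hno
  have h : D.IsObstruction s p :=
    { loopless := hloop
      connected := hconn
      out_le := fun v => (le_max_left _ _).trans ((D.max_degree_le_maxSemidegree v).trans hle)
      in_le := fun v => (le_max_right _ _).trans ((D.max_degree_le_maxSemidegree v).trans hle)
      not_colorable := fun ⟨f, hf⟩ => hno (Digraph.hasDegeneratePartition_of_coloring hf) }
  -- For p = 0 there are no arcs and D is one vertex; for p = 1 rigidity makes every degree equal to
  -- s.
  obtain rfl | rfl | hp2 : p = 0 ∨ p = 1 ∨ 2 ≤ p := by omega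
  · exact hcomplete (Digraph.isBidirectedComplete_of_maxSemidegree_eq_zero hloop hconn (by omega))
  · have hdeg : ∀ v, D.outDegree v = s ∧ D.inDegree v = s := fun v => by
      have := h.ncard_adj one_pos v
      rwa [Nat.one_mul] at this
    exact hregular ⟨fun v => (hdeg v).1.trans (hdeg v).2.symm, hdeg⟩
  · exact (h.isBidirectedComplete_or_isBidirectedOddCycle hs hp2).elim hcomplete hcycle
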